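/- Let $n\ge 3$, let $P_1,\dots,P_n$ be the consecutive vertices of a regular $n$-gon inscribed in a circle of radius $1$ with centre $O$, let $\Gamma$ be the circle of radius $r>0$ with centre $O$, and let $B_i$ be the point at which the ray $OP_i$ meets $\Gamma$. For a real number $\lambda$ and $X\in\Gamma$ (with $X\ne P_1,\dots,P_n$ if $\lambda<0$) put $R_n(X,\lambda)=\sum_{i=1}^n XP_i^{\lambda}$, where $0^0=1$. Call $X\in\Gamma$ a midpoint if it bisects the arc of $\Gamma$ between two consecutive vertices of the polygon $B_1\dots B_n$. 1. Let $\lambda<0$. Then $R_n(\cdot,\lambda)$ attains its minimum on $\Gamma\setminus\{P_1,\dots,P_n\}$ exactly at the midpoints. If $r\neq1$, it attains its maximum on $\Gamma$ exactly at the points $B_i$. If $r=1$, it is unbounded above on $\Gamma\setminus\{P_1,\dots,P_n\}$, and $R_n(X,\lambda)\to\infty$ as $X\to B_i$ in this set, for every $i$. 2. Let $0\le\lambda<2n$. If $\lambda$ is an even integer, then $R_n(X,\lambda)$ does not depend on $X\in\Gamma$. Otherwise let $m$ be the integer with $2m\le\lambda\le 2m+2$. If $m$ is even, then $R_n(X,\lambda)$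 is maximal on $\Gamma$ if and only if $X$ is a midpoint, and minimal if and only if $X$ is one of the $B_i$. If $m$ is odd, then $R_n(X,\lambda)$ is minimal on $\Gamma$ if and only if $X$ is a midpoint, and maximal if and only if $X$ is one of the $B_i$. 3. Let $\lambda\ge 2n$. If $n$ is even, $R_n(\cdot,\lambda)$ attains its maximum on $\Gamma$ exactly at the points $B_i$ and its minimum exactly at the midpoints. If $n$ is odd, it attains its minimum exactly at the points $B_i$ and its maximum exactly at the midpoints. -/

import Mathlib

open Set Filter Topology

/-- `P 0, …, P (n-1)` are, in cyclic order (counterclockwise or clockwise), the vertices of a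
regular `n`-gon inscribed in the circle of radius `1` about `O`. -/
def IsRegularPolygonOnUnitCircle {n : ℕ} (O : ℂ) (P : Fin n → ℂ) : Prop :=
  ∃ u ω : ℂ, ‖u‖ = 1 ∧
    (ω = Complex.exp (2 * Real.pi * Complex.I / n) ∨
      ω = Complex.exp (-(2 * Real.pi * Complex.I / n))) ∧
    ∀ k : Fin n, P k = O + u * ω ^ (k : ℕ)

/-- `B` is the point where the ray from `O` through `P` meets the circle of radius `r`
about `O`. -/
def IsRayCirclePoint (O : ℂ) (r : ℝ) (P B : ℂ) : Prop :=
  B ∈ Metric.sphere O r ∧ SameRay ℝ (P - O) (B - O)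

/-- The point `X` of a circle centred at `O` bisects the (shorter) arc between the points `A` and
`C` of that circle: each of the central angles `AOX` and `XOC` is one half of `AOC`. -/
def BisectsArc (O A C X : ℂ) : Prop :=
  EuclideanGeometry.angle A O X = EuclideanGeometry.angle A O C / 2 ∧
    EuclideanGeometry.angle X O C = EuclideanGeometry.angle A O C / 2

/-- `X` bisects one of the arcs between cyclically consecutive vertices of `B 0, …, B (n-1)`
(the addition in `Fin n` is modulo `n`). -/
def BisectsConsecutiveArc {n : ℕ} [NeZero n] (O : ℂ) (B : Fin n → ℂ) (X : ℂ) : Prop :=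
  ∃ k : Fin n, BisectsArc O (B k) (B (k + 1)) X

/-- The sum `∑ XP_k ^ lam` of powers of the distances from `X` to the points `P k`. It is used for
`lam < 0` only where `X` differs from all the `P k`. -/
noncomputable def distPowSum {n : ℕ} (P : Fin n → ℂ) (lam : ℝ) (X : ℂ) : ℝ :=
  ∑ k : Fin n, dist X (P k) ^ lam

/-!
In polar coordinates centred at `O`, with `θ` the polar angle of `X` relative to a vertex, the sum
is `∑ F (cos (θ - 2πk/n))` with `F x = (1 + r² - 2rx) ^ (lam / 2)` (`distPowSum_polarPoint`). It is
even and `2π/n`-periodic in `θ`, hence a function of `cos (nθ)`, so it suffices to study it for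
`θ ∈ [0, π/n]`, where `0` corresponds to the vertices `B k` and `π/n` to the midpoints
(`exists_foldedAngle`).

The nodes `x_k = cos (θ - 2πk/n)` are the roots of the Chebyshev equation `T_n x = cos (nθ)`
(`two_pow_mul_nodal_eq_T_sub_C`). Differentiating `T_n (cos x) = cos (n x)` gives
`sin (θ - 2πk/n) = n sin (nθ) / T_n' (x_k)`, so the derivative of the sum with respect to `θ` is
`-n sin (nθ) ∑ F' (x_k) / T_n' (x_k)`, a negative multiple of the divided difference of `F'` at the
`n` distinct nodes. By an iterated Rolle argument this divided difference is `F⁽ⁿ⁾ ξ / (n - 1)!` for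
some `ξ < 1` (`exists_sum_nodalWeight_eq_div_factorial`). Since
`F⁽ⁿ⁾ x = (2r)ⁿ ∏_{j < n} (j - lam / 2) (1 + r² - 2rx) ^ (lam / 2 - n)`, the derivative has on
`(0, π/n)` the constant sign of `-∏_{j < n} (j - lam / 2)` (`exists_hasDerivAt_sqDistPowSum`). Thus
the sum is strictly monotone or constant on `[0, π/n]`, and counting the negative factors of the
product decides which: none for `lam < 0`, `m + 1` of them for `2m < lam < 2m + 2`, all `n` for
`lam ≥ 2n`, and a zero factor for an even integer `lam` in `[0, 2n)`.
-/

/-! ### Divided differences as values of a derivative -/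

/-- Iterated Rolle theorem: if `f 0` has `N + 1` zeros on an order-connected set on which
`f (i + 1)` is the derivative of `f i`, then `f N` has a zero there. -/
theorem exists_eq_zero_of_card_zeros {s : Set ℝ} (hs : s.OrdConnected) (N : ℕ) :
    ∀ f : ℕ → ℝ → ℝ, (∀ i, ∀ x ∈ s, HasDerivAt (f i) (f (i + 1) x) x) →
      ∀ Z : Finset ℝ, (Z : Set ℝ) ⊆ s → Z.card = N + 1 → (∀ z ∈ Z, f 0 z = 0) →
        ∃ ξ ∈ s, f N ξ = 0 := by
  induction N with
  | zero =>
    intro f _ Z hZs hZ hf0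
    obtain ⟨z, hz⟩ := Finset.card_pos.1 (by omega : 0 < Z.card)
    exact ⟨z, hZs hz, hf0 z hz⟩
  | succ N ih =>
    intro f hf Z hZs hZ hf0
    let e := Z.orderEmbOfFin hZ
    have he : ∀ i, e i ∈ Z := Z.orderEmbOfFin_mem hZ
    have hlt : ∀ i : Fin (N + 1), e i.castSucc < e i.succ := fun i =>
      e.strictMono i.castSucc_lt_succ
    have hsub : ∀ i : Fin (N + 1), Icc (e i.castSucc) (e i.succ) ⊆ s := fun i =>
      hs.out (hZs (he _)) (hZs (he _))
    have hrolle : ∀ i : Fin (N + 1), ∃ c ∈ Ioo (e i.castSucc) (e i.succ), f 1 c = 0 := fun i =>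
      exists_hasDerivAt_eq_zero (hlt i)
        (fun x hx => (hf 0 x (hsub i hx)).continuousAt.continuousWithinAt)
        ((hf0 _ (he _)).trans (hf0 _ (he _)).symm)
        (fun x hx => hf 0 x (hsub i (Ioo_subset_Icc_self hx)))
    choose c hc hc0 using hrolle
    have hmono : StrictMono c := by
      intro i j hij
      have h1 : e i.succ ≤ e j.castSucc := e.monotone (Fin.succ_le_castSucc_iff.2 hij)
      exact (hc i).2.trans_le (h1.trans (hc j).1.le)
    refine ih (fun i => f (i + 1)) (fun i => hf (i + 1)) (Finset.univ.image c) ?_ ?_ ?_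
    · intro x hx
      obtain ⟨i, -, rfl⟩ := Finset.mem_image.1 (Finset.mem_coe.1 hx)
      exact hsub i (Ioo_subset_Icc_self (hc i))
    · rw [Finset.card_image_of_injective _ hmono.injective, Finset.card_fin]
    · intro z hz
      obtain ⟨i, -, rfl⟩ := Finset.mem_image.1 hz
      exact hc0 i

/-- Mean value theorem for divided differences: the divided difference of `f 0` at `N + 1` distinct
nodes is `1 / N!` times a value of the `N`-th derivative `f N`. -/
theorem exists_sum_nodalWeight_eq_div_factorial {ι : Type*} [DecidableEq ι] {s : Set ℝ}
    (hs : s.OrdConnected) {N : ℕ} {f : ℕ → ℝ → ℝ}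
    (hf : ∀ i, ∀ x ∈ s, HasDerivAt (f i) (f (i + 1) x) x)
    {t : Finset ι} (ht : t.card = N + 1) {v : ι → ℝ} (hv : Set.InjOn v t)
    (hvs : ∀ i ∈ t, v i ∈ s) :
    ∃ ξ ∈ s, ∑ i ∈ t, f 0 (v i) * Lagrange.nodalWeight t v i = f N ξ / N.factorial := by
  set p : Polynomial ℝ := Lagrange.interpolate t v (fun i => f 0 (v i)) with hp
  have hpdeg : p.degree < t.card := Lagrange.degree_interpolate_lt _ hv
  -- the `N`-th derivative of the interpolation polynomial is `N!` times the divided difference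
  have hpN : ∀ x, (Polynomial.derivative^[N] p).eval x =
      N.factorial * ∑ i ∈ t, f 0 (v i) * Lagrange.nodalWeight t v i := by
    intro x
    rw [Lagrange.eval_iterate_derivative_eq_sum hv hpdeg (by omega)]
    congr 1
    refine Finset.sum_congr rfl fun i hi => ?_
    rw [hp, Lagrange.eval_interpolate_at_node _ hv hi, ht]
    simp [Lagrange.nodalWeight, div_eq_mul_inv]
  obtain ⟨ξ, hξ, h0⟩ := exists_eq_zero_of_card_zeros hs N
    (fun i x => f i x - (Polynomial.derivative^[i] p).eval x)
    (fun i x hx => by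
      rw [Function.iterate_succ_apply']
      exact (hf i x hx).sub (Polynomial.hasDerivAt _ x))
    (t.image v) (by
      intro x hx
      obtain ⟨i, hi, rfl⟩ := Finset.mem_image.1 (Finset.mem_coe.1 hx)
      exact hvs i hi)
    (by rw [Finset.card_image_of_injOn hv, ht])
    (fun z hz => by
      obtain ⟨i, hi, rfl⟩ := Finset.mem_image.1 hz
      exact sub_eq_zero.2 (Lagrange.eval_interpolate_at_node (fun i => f 0 (v i)) hv hi).symm)
  refine ⟨ξ, hξ, ?_⟩
  rw [eq_div_iff (by positivity), mul_comm, ← hpN ξ]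
  linarith

/-! ### Chebyshev nodes -/

/-- The angle, seen from the centre, between a point at polar angle `θ` and the `k`-th vertex
`2πk/n` of a regular `n`-gon. -/
noncomputable def vertexAngle (n : ℕ) (θ : ℝ) (k : ℕ) : ℝ :=
  θ - 2 * Real.pi * k / n

theorem nat_mul_vertexAngle {n : ℕ} (hn : n ≠ 0) (θ : ℝ) (k : ℕ) :
    n * vertexAngle n θ k = n * θ - k * (2 * Real.pi) := by
  have : (n : ℝ) ≠ 0 := Nat.cast_ne_zero.2 hn
  unfold vertexAngle
  field_simp

theorem cos_nat_mul_vertexAngle {n : ℕ} (hn : n ≠ 0) (θ : ℝ) (k : ℕ) :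
    Real.cos (n * vertexAngle n θ k) = Real.cos (n * θ) := by
  rw [nat_mul_vertexAngle hn, Real.cos_sub_nat_mul_two_pi]

theorem sin_nat_mul_vertexAngle {n : ℕ} (hn : n ≠ 0) (θ : ℝ) (k : ℕ) :
    Real.sin (n * vertexAngle n θ k) = Real.sin (n * θ) := by
  rw [nat_mul_vertexAngle hn, Real.sin_sub_nat_mul_two_pi]

theorem injOn_cos_vertexAngle {n : ℕ} (hn : n ≠ 0) {θ : ℝ} (hθ : Real.sin (n * θ) ≠ 0) :
    Set.InjOn (fun k => Real.cos (vertexAngle n θ k)) (Finset.range n) := by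
  have hn' : (n : ℝ) ≠ 0 := Nat.cast_ne_zero.2 hn
  intro j hj k hk hjk
  have hj : j < n := by simpa using hj
  have hk : k < n := by simpa using hk
  obtain ⟨m, hm | hm⟩ := Real.cos_eq_cos_iff.1 hjk
  · have h1 : ((j : ℤ) : ℝ) - (k : ℤ) = (n * m : ℤ) := by
      unfold vertexAngle at hm
      push_cast
      field_simp at hm
      have := Real.pi_pos.ne'
      apply mul_left_cancel₀ (mul_ne_zero two_ne_zero this)
      linarith
    have h2 : (j : ℤ) - k = n * m := by exact_mod_cast h1
    have h3 : (j : ℤ) ≡ k [ZMOD n] := (Int.modEq_iff_dvd.2 ⟨-m, by linarith⟩)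
    have h4 : j ≡ k [MOD n] := (Int.natCast_modEq_iff).1 h3
    exact Nat.ModEq.eq_of_lt_of_lt h4 hj hk
  · exfalso
    apply hθ
    rw [Real.sin_eq_zero_iff]
    refine ⟨n * m + j + k, ?_⟩
    unfold vertexAngle at hm
    field_simp at hm
    push_cast
    linarith

open Polynomial in
/-- The numbers `cos (θ - 2πk/n)` are the roots of `T_n - cos (nθ)`. -/
theorem two_pow_mul_nodal_eq_T_sub_C {n : ℕ} (hn : n ≠ 0) {θ : ℝ} (hθ : Real.sin (n * θ) ≠ 0) :
    C ((2 : ℝ) ^ (n - 1)) *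
        Lagrange.nodal (Finset.range n) (fun k => Real.cos (vertexAngle n θ k)) =
      Chebyshev.T ℝ n - C (Real.cos (n * θ)) := by
  have hdeg : (C (Real.cos (n * θ))).degree < (Chebyshev.T ℝ n).degree := by
    rw [Chebyshev.degree_T]
    refine degree_C_le.trans_lt ?_
    simpa using Nat.pos_of_ne_zero hn
  have h2 : (2 : ℝ) ^ (n - 1) ≠ 0 := by positivity
  refine eq_of_degree_le_of_eval_index_eq (Finset.range n)
    (injOn_cos_vertexAngle hn hθ) ?_ ?_ ?_ ?_
  · rw [degree_C_mul h2, Lagrange.degree_nodal]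
  · rw [degree_C_mul h2, Lagrange.degree_nodal, degree_sub_eq_left_of_degree_lt hdeg,
      Chebyshev.degree_T]
    simp
  · rw [leadingCoeff_mul, leadingCoeff_C, Lagrange.nodal_monic.leadingCoeff,
      leadingCoeff_sub_of_degree_lt hdeg, Chebyshev.leadingCoeff_T]
    simp
  · intro k hk
    have h := Lagrange.eval_nodal_at_node (v := fun k => Real.cos (vertexAngle n θ k)) hk
    rw [eval_mul, h, mul_zero, eval_sub, Chebyshev.T_real_cos, eval_C]
    simp [cos_nat_mul_vertexAngle hn]

open Polynomial in
/-- Differentiating `T_n (cos x) = cos (n x)` expresses `sin (θ - 2πk/n)` through the nodal weight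
of the Chebyshev node `cos (θ - 2πk/n)`. -/
theorem sin_vertexAngle_eq_nodalWeight {n : ℕ} (hn : n ≠ 0) {θ : ℝ} (hθ : Real.sin (n * θ) ≠ 0)
    {k : ℕ} (hk : k < n) :
    Real.sin (vertexAngle n θ k) = n * Real.sin (n * θ) / 2 ^ (n - 1) *
      Lagrange.nodalWeight (Finset.range n) (fun k => Real.cos (vertexAngle n θ k)) k := by
  set v : ℕ → ℝ := fun k => Real.cos (vertexAngle n θ k) with hv
  set x := vertexAngle n θ k with hx
  have hw : Lagrange.nodalWeight (Finset.range n) v k ≠ 0 :=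
    Lagrange.nodalWeight_ne_zero (injOn_cos_vertexAngle hn hθ) (Finset.mem_range.2 hk)
  have h1 : HasDerivAt (fun y => (Chebyshev.T ℝ n).eval (Real.cos y))
      ((derivative (Chebyshev.T ℝ n)).eval (Real.cos x) * (-Real.sin x)) x :=
    ((Chebyshev.T ℝ n).hasDerivAt (Real.cos x)).comp x (Real.hasDerivAt_cos x)
  have h2 : HasDerivAt (fun y => (Chebyshev.T ℝ n).eval (Real.cos y))
      (-Real.sin (n * x) * (n * 1)) x := by
    have : (fun y => (Chebyshev.T ℝ n).eval (Real.cos y)) = fun y => Real.cos (n * y) := by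
      funext y
      simp [Chebyshev.T_real_cos]
    rw [this]
    exact ((hasDerivAt_id x).const_mul (n : ℝ)).cos
  have h3 := h1.unique h2
  rw [hx, sin_nat_mul_vertexAngle hn, ← hx] at h3
  have h4 : (derivative (Chebyshev.T ℝ n)).eval (Real.cos x) =
      2 ^ (n - 1) * (Lagrange.nodalWeight (Finset.range n) v k)⁻¹ := by
    rw [Lagrange.nodalWeight_eq_eval_derivative_nodal (Finset.mem_range.2 hk), inv_inv]
    have := congrArg (fun q => (derivative q).eval (v k)) (two_pow_mul_nodal_eq_T_sub_C hn hθ)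
    simp only [derivative_sub, derivative_C, sub_zero, derivative_C_mul, eval_mul, eval_C] at this
    exact this.symm
  rw [h4] at h3
  field_simp at h3 ⊢
  linarith

/-! ### Monotonicity of the power sum in the polar angle -/

/-- The sum of the `a`-th powers of the squared distances from the point at polar angle `θ` on the
circle of radius `r` to the vertices at the angles `2πk/n` of the unit circle. -/
noncomputable def sqDistPowSum (n : ℕ) (r a θ : ℝ) : ℝ :=
  ∑ k ∈ Finset.range n, (1 + r ^ 2 - 2 * r * Real.cos (vertexAngle n θ k)) ^ a

/-- The `i`-th derivative of `x ↦ (1 + r² - 2rx) ^ a`, valid where `0 < 1 + r² - 2rx`. -/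
noncomputable def sqDistPowDeriv (r a : ℝ) (i : ℕ) (x : ℝ) : ℝ :=
  (2 * r) ^ i * (∏ j ∈ Finset.range i, ((j : ℝ) - a)) * (1 + r ^ 2 - 2 * r * x) ^ (a - i)

theorem one_add_sq_sub_pos {r x : ℝ} (hr : 0 < r) (hx : x < 1) : 0 < 1 + r ^ 2 - 2 * r * x := by
  nlinarith [sq_nonneg (1 - r), mul_pos hr (sub_pos.2 hx)]

theorem hasDerivAt_sqDistPowDeriv {r : ℝ} (a : ℝ) (i : ℕ) {x : ℝ}
    (hx : 0 < 1 + r ^ 2 - 2 * r * x) :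
    HasDerivAt (sqDistPowDeriv r a i) (sqDistPowDeriv r a (i + 1) x) x := by
  have h1 : HasDerivAt (fun x => 1 + r ^ 2 - 2 * r * x) (-(2 * r * 1)) x :=
    ((hasDerivAt_id x).const_mul (2 * r)).const_sub (1 + r ^ 2)
  have h2 := (h1.rpow_const (p := a - i) (Or.inl hx.ne')).const_mul
    ((2 * r) ^ i * ∏ j ∈ Finset.range i, ((j : ℝ) - a))
  refine h2.congr_deriv ?_
  rw [sqDistPowDeriv, Finset.prod_range_succ, pow_succ,
    show a - ((i + 1 : ℕ) : ℝ) = a - i - 1 by push_cast; ring]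
  ring

theorem nat_mul_mem_Ioo {n : ℕ} (hn : n ≠ 0) {θ : ℝ} (hθ : θ ∈ Ioo 0 (Real.pi / n)) :
    n * θ ∈ Ioo 0 Real.pi := by
  have hn' : (0 : ℝ) < n := Nat.cast_pos.2 (Nat.pos_of_ne_zero hn)
  exact ⟨mul_pos hn' hθ.1, by rw [mul_comm]; exact (lt_div_iff₀ hn').1 hθ.2⟩

theorem nat_mul_mem_Icc {n : ℕ} (hn : n ≠ 0) {θ : ℝ} (hθ : θ ∈ Icc 0 (Real.pi / n)) :
    n * θ ∈ Icc 0 Real.pi := by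
  have hn' : (0 : ℝ) < n := Nat.cast_pos.2 (Nat.pos_of_ne_zero hn)
  exact ⟨mul_nonneg hn'.le hθ.1, by rw [mul_comm]; exact (le_div_iff₀ hn').1 hθ.2⟩

theorem cos_vertexAngle_lt_one {n : ℕ} (hn : n ≠ 0) {θ : ℝ} (hθ : Real.cos (n * θ) ≠ 1) (k : ℕ) :
    Real.cos (vertexAngle n θ k) < 1 := by
  refine (Real.cos_le_one _).lt_of_ne fun h => hθ ?_
  obtain ⟨m, hm⟩ := (Real.cos_eq_one_iff _).1 h
  rw [← cos_nat_mul_vertexAngle hn θ k, ← hm, Real.cos_eq_one_iff]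
  exact ⟨n * m, by push_cast; ring⟩

theorem continuous_vertexAngle (n k : ℕ) : Continuous fun θ => vertexAngle n θ k := by
  unfold vertexAngle
  fun_prop

/-- The derivative of the power sum is a divided difference at the Chebyshev nodes, hence a value of
the `n`-th derivative of `x ↦ (1 + r² - 2rx) ^ a`, the sign of which does not depend on `x`. -/
theorem exists_hasDerivAt_sqDistPowSum {n : ℕ} (hn : n ≠ 0) {r : ℝ} (hr : 0 < r) (a : ℝ) {θ : ℝ}
    (hθ : θ ∈ Ioo 0 (Real.pi / n)) :
    ∃ K > 0, HasDerivAt (sqDistPowSum n r a) (-(K * ∏ j ∈ Finset.range n, ((j : ℝ) - a))) θ := by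
  have hθ' := nat_mul_mem_Ioo hn hθ
  have hsin : 0 < Real.sin (n * θ) := Real.sin_pos_of_mem_Ioo hθ'
  have hcos : Real.cos (n * θ) ≠ 1 := fun h => by
    have := Real.sin_sq_add_cos_sq (n * θ)
    rw [h] at this
    nlinarith
  obtain ⟨N, rfl⟩ := Nat.exists_eq_succ_of_ne_zero hn
  set n := N + 1 with hnN
  set v : ℕ → ℝ := fun k => Real.cos (vertexAngle n θ k) with hv
  obtain ⟨ξ, hξ, hsum⟩ := exists_sum_nodalWeight_eq_div_factorial (s := Iio 1) (N := N)
    ordConnected_Iio (f := fun i => sqDistPowDeriv r a (i + 1))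
    (fun i x hx => hasDerivAt_sqDistPowDeriv a (i + 1) (one_add_sq_sub_pos hr hx))
    (t := Finset.range n) (by simp [hnN]) (injOn_cos_vertexAngle hn hsin.ne')
    (fun k _ => cos_vertexAngle_lt_one hn hcos k)
  refine ⟨n * Real.sin (n * θ) / 2 ^ (n - 1) * ((2 * r) ^ n * (1 + r ^ 2 - 2 * r * ξ) ^ (a - n) /
    N.factorial), ?_, ?_⟩
  · have := Real.rpow_pos_of_pos (one_add_sq_sub_pos hr hξ) (a - n)
    positivity
  · have hterm : ∀ k ∈ Finset.range n, HasDerivAt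
        (fun θ => (1 + r ^ 2 - 2 * r * Real.cos (vertexAngle n θ k)) ^ a)
        (sqDistPowDeriv r a 1 (v k) * -Real.sin (vertexAngle n θ k)) θ := by
      intro k _
      have h1 : HasDerivAt (fun θ => vertexAngle n θ k) 1 θ := by
        unfold vertexAngle
        exact (hasDerivAt_id θ).sub_const _
      have h2 := hasDerivAt_sqDistPowDeriv a 0
        (one_add_sq_sub_pos hr (cos_vertexAngle_lt_one hn hcos k))
      have h3 := h2.comp θ h1.cos
      simpa [sqDistPowDeriv, Function.comp_def] using h3
    have h := HasDerivAt.fun_sum hterm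
    refine h.congr_deriv ?_
    have : ∀ k ∈ Finset.range n, sqDistPowDeriv r a 1 (v k) * -Real.sin (vertexAngle n θ k) =
        -(n * Real.sin (n * θ) / 2 ^ (n - 1)) * (sqDistPowDeriv r a (0 + 1) (v k) *
          Lagrange.nodalWeight (Finset.range n) v k) := by
      intro k hk
      rw [sin_vertexAngle_eq_nodalWeight hn hsin.ne' (Finset.mem_range.1 hk)]
      ring
    rw [Finset.sum_congr rfl this, ← Finset.mul_sum, hsum, sqDistPowDeriv, ← hnN]
    ring

theorem mem_Ioo_of_mem_interior {D : Set ℝ} {n : ℕ}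
    (hDn : D ⊆ Icc 0 (Real.pi / n)) {θ : ℝ} (hθ : θ ∈ interior D) : θ ∈ Ioo 0 (Real.pi / n) := by
  simpa using interior_mono hDn hθ

theorem strictAntiOn_sqDistPowSum {n : ℕ} (hn : n ≠ 0) {r a : ℝ} (hr : 0 < r)
    (ha : 0 < ∏ j ∈ Finset.range n, ((j : ℝ) - a)) {D : Set ℝ} (hD : Convex ℝ D)
    (hDn : D ⊆ Icc 0 (Real.pi / n)) (hcont : ContinuousOn (sqDistPowSum n r a) D) :
    StrictAntiOn (sqDistPowSum n r a) D := by
  refine strictAntiOn_of_deriv_neg hD hcont fun θ hθ => ?_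
  obtain ⟨K, hK, h⟩ := exists_hasDerivAt_sqDistPowSum hn hr a
    (mem_Ioo_of_mem_interior hDn hθ)
  rw [h.deriv]
  exact neg_neg_of_pos (mul_pos hK ha)

theorem strictMonoOn_sqDistPowSum {n : ℕ} (hn : n ≠ 0) {r a : ℝ} (hr : 0 < r)
    (ha : ∏ j ∈ Finset.range n, ((j : ℝ) - a) < 0) {D : Set ℝ} (hD : Convex ℝ D)
    (hDn : D ⊆ Icc 0 (Real.pi / n)) (hcont : ContinuousOn (sqDistPowSum n r a) D) :
    StrictMonoOn (sqDistPowSum n r a) D := by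
  refine strictMonoOn_of_deriv_pos hD hcont fun θ hθ => ?_
  obtain ⟨K, hK, h⟩ := exists_hasDerivAt_sqDistPowSum hn hr a
    (mem_Ioo_of_mem_interior hDn hθ)
  rw [h.deriv]
  exact neg_pos_of_neg (mul_neg_of_pos_of_neg hK ha)

theorem continuous_sqDistPowSum (n : ℕ) (r : ℝ) {a : ℝ} (ha : 0 ≤ a) :
    Continuous (sqDistPowSum n r a) := by
  refine continuous_finsetSum _ fun k _ => ?_
  exact (Real.continuous_rpow_const ha).comp
    (continuous_const.sub (continuous_const.mul (Real.continuous_cos.comp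
      (continuous_vertexAngle n k))))

theorem continuousOn_sqDistPowSum {n : ℕ} {r : ℝ} (a : ℝ) {D : Set ℝ}
    (hD : ∀ θ ∈ D, ∀ k, 0 < 1 + r ^ 2 - 2 * r * Real.cos (vertexAngle n θ k)) :
    ContinuousOn (sqDistPowSum n r a) D := by
  refine continuousOn_finsetSum _ fun k _ => ContinuousOn.rpow_const ?_
    fun θ hθ => Or.inl (hD θ hθ k).ne'
  exact (continuous_const.sub (continuous_const.mul (Real.continuous_cos.comp
      (continuous_vertexAngle n k)))).continuousOn

/-- If `a` is one of `0, …, n - 1`, the `n`-th derivative vanishes and the sum is constant. -/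
theorem sqDistPowSum_eq_of_prod_eq_zero {n : ℕ} (hn : n ≠ 0) {r a : ℝ} (hr : 0 < r) (ha0 : 0 ≤ a)
    (ha : ∏ j ∈ Finset.range n, ((j : ℝ) - a) = 0) {θ φ : ℝ} (hθ : θ ∈ Icc 0 (Real.pi / n))
    (hφ : φ ∈ Icc 0 (Real.pi / n)) : sqDistPowSum n r a θ = sqDistPowSum n r a φ := by
  have hderiv : ∀ x ∈ interior (Icc 0 (Real.pi / n)),
      HasDerivAt (sqDistPowSum n r a) 0 x := by
    intro x hx
    obtain ⟨K, -, h⟩ := exists_hasDerivAt_sqDistPowSum hn hr a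
      (mem_Ioo_of_mem_interior Subset.rfl hx)
    simpa [ha] using h
  have hcont := (continuous_sqDistPowSum n r ha0).continuousOn (s := Icc 0 (Real.pi / n))
  have hdiff : DifferentiableOn ℝ (sqDistPowSum n r a) (interior (Icc 0 (Real.pi / n))) :=
    fun x hx => (hderiv x hx).differentiableAt.differentiableWithinAt
  have hmono := monotoneOn_of_deriv_nonneg (convex_Icc _ _) hcont hdiff
    fun x hx => (hderiv x hx).deriv.ge
  have hanti := antitoneOn_of_deriv_nonpos (convex_Icc _ _) hcont hdiff
    fun x hx => (hderiv x hx).deriv.le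
  rcases le_total θ φ with h | h
  · exact (hmono hθ hφ h).antisymm (hanti hθ hφ h)
  · exact (hanti hφ hθ h).antisymm (hmono hφ hθ h)

/-! ### Symmetries of the power sum -/

theorem sqDistPowSum_add_two_pi_div {n : ℕ} (hn : n ≠ 0) (r a θ : ℝ) :
    sqDistPowSum n r a (θ + 2 * Real.pi / n) = sqDistPowSum n r a θ := by
  have hn' : (n : ℝ) ≠ 0 := Nat.cast_ne_zero.2 hn
  let f : ℕ → ℝ := fun k =>
    (1 + r ^ 2 - 2 * r * Real.cos (vertexAngle n (θ + 2 * Real.pi / n) k)) ^ a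
  have h1 : f n = f 0 := by
    have : vertexAngle n (θ + 2 * Real.pi / n) n =
        vertexAngle n (θ + 2 * Real.pi / n) 0 - 2 * Real.pi := by
      unfold vertexAngle
      field_simp
      push_cast
      ring
    simp only [f, this, Real.cos_sub_two_pi]
  have h2 : ∀ k, f (k + 1) = (1 + r ^ 2 - 2 * r * Real.cos (vertexAngle n θ k)) ^ a := by
    intro k
    have : vertexAngle n (θ + 2 * Real.pi / n) (k + 1) = vertexAngle n θ k := by
      unfold vertexAngle
      push_cast
      ring
    simp only [f, this]
  have h3 := (Finset.sum_range_succ f n).symm.trans (Finset.sum_range_succ' f n)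
  rw [h1, add_left_inj] at h3
  exact h3.trans (Finset.sum_congr rfl fun k _ => h2 k)

/-- Up to the shift by one vertex, the reflection reverses the order of the summands. -/
theorem sqDistPowSum_neg {n : ℕ} (hn : n ≠ 0) (r a θ : ℝ) :
    sqDistPowSum n r a (-θ) = sqDistPowSum n r a θ := by
  have hn' : (n : ℝ) ≠ 0 := Nat.cast_ne_zero.2 hn
  have hshift := sqDistPowSum_add_two_pi_div hn r a (θ - 2 * Real.pi / n)
  rw [sub_add_cancel] at hshift
  rw [hshift, sqDistPowSum, sqDistPowSum, ← Finset.sum_range_reflect]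
  refine Finset.sum_congr rfl fun k hk => ?_
  have hk : k < n := Finset.mem_range.1 hk
  have : vertexAngle n (-θ) (n - 1 - k) =
      -(vertexAngle n (θ - 2 * Real.pi / n) k + 2 * Real.pi) := by
    unfold vertexAngle
    rw [Nat.cast_sub (by omega), Nat.cast_sub (by omega)]
    field_simp
    push_cast
    ring
  rw [this, Real.cos_neg, Real.cos_add_two_pi]

/-- The power sum is a function of `cos (nθ)`. -/
theorem sqDistPowSum_eq_of_cos_eq {n : ℕ} (hn : n ≠ 0) (r a : ℝ) {θ φ : ℝ}
    (h : Real.cos (n * θ) = Real.cos (n * φ)) :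
    sqDistPowSum n r a θ = sqDistPowSum n r a φ := by
  have hn' : (n : ℝ) ≠ 0 := Nat.cast_ne_zero.2 hn
  have hper : Function.Periodic (sqDistPowSum n r a) (2 * Real.pi / n) :=
    sqDistPowSum_add_two_pi_div hn r a
  obtain ⟨m, hm | hm⟩ := Real.cos_eq_cos_iff.1 h
  · have : φ = θ + m * (2 * Real.pi / n) := by
      field_simp
      linarith
    rw [this, hper.int_mul m θ]
  · have : φ = -θ + m * (2 * Real.pi / n) := by
      field_simp
      linarith
    rw [this, hper.int_mul m, sqDistPowSum_neg hn]

/-! ### Polar coordinates on circles about `O` -/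

/-- The point at distance `r` from `O` (for `0 ≤ r`) at polar angle `θ`, measured from the direction
`u`, counterclockwise for `ε = 1` and clockwise for `ε = -1`. -/
noncomputable def polarPoint (O u : ℂ) (ε r θ : ℝ) : ℂ :=
  O + u * (r * Complex.exp ((ε * θ : ℝ) * Complex.I))

theorem cos_sign_mul {ε : ℝ} (hε : ε = 1 ∨ ε = -1) (x : ℝ) : Real.cos (ε * x) = Real.cos x := by
  rcases hε with rfl | rfl <;> simp

theorem polarPoint_add_two_pi {ε : ℝ} (hε : ε = 1 ∨ ε = -1) (O u : ℂ) (r θ : ℝ) :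
    polarPoint O u ε r (θ + 2 * Real.pi) = polarPoint O u ε r θ := by
  have : Complex.exp ((ε * (θ + 2 * Real.pi) : ℝ) * Complex.I) =
      Complex.exp ((ε * θ : ℝ) * Complex.I) := by
    rw [Complex.exp_eq_exp_iff_exists_int]
    rcases hε with rfl | rfl
    · exact ⟨1, by push_cast; ring⟩
    · exact ⟨-1, by push_cast; ring⟩
  rw [polarPoint, this, polarPoint]

section

variable {O u : ℂ} {ε : ℝ}

theorem polarPoint_mem_sphere (hu : ‖u‖ = 1) {r : ℝ} (hr : 0 < r) (θ : ℝ) :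
    polarPoint O u ε r θ ∈ Metric.sphere O r := by
  simp [polarPoint, hu, Complex.norm_exp_ofReal_mul_I, abs_of_pos hr, -Complex.ofReal_mul]

theorem exists_polarPoint_eq (hu : ‖u‖ = 1) (hε : ε = 1 ∨ ε = -1) {r : ℝ} (hr : 0 < r) {X : ℂ}
    (hX : X ∈ Metric.sphere O r) : ∃ θ, X = polarPoint O u ε r θ := by
  have hu0 : u ≠ 0 := by rintro rfl; simp at hu
  have hr0 : (r : ℂ) ≠ 0 := Complex.ofReal_ne_zero.2 hr.ne'
  have hεε : ε * ε = 1 := by rcases hε with rfl | rfl <;> norm_num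
  have hnorm : ‖(X - O) / u‖ = r := by
    rw [norm_div, hu, div_one, ← dist_eq_norm]
    exact hX
  refine ⟨ε * ((X - O) / u).arg, ?_⟩
  have h := Complex.norm_mul_exp_arg_mul_I ((X - O) / u)
  rw [hnorm] at h
  rw [polarPoint, ← mul_assoc ε, hεε, one_mul, h]
  field_simp
  ring

theorem dist_polarPoint_sq (hu : ‖u‖ = 1) (hε : ε = 1 ∨ ε = -1) (r s θ φ : ℝ) :
    dist (polarPoint O u ε r θ) (polarPoint O u ε s φ) ^ 2 =
      s ^ 2 + r ^ 2 - 2 * r * s * Real.cos (θ - φ) := by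
  have h1 : dist (polarPoint O u ε r θ) (polarPoint O u ε s φ) =
      ‖r * Complex.exp ((ε * θ : ℝ) * Complex.I) - s * Complex.exp ((ε * φ : ℝ) * Complex.I)‖ := by
    rw [dist_eq_norm, polarPoint, polarPoint, add_sub_add_left_eq_sub, ← mul_sub, norm_mul, hu,
      one_mul]
  have h2 : Real.cos (θ - φ) = Real.cos (ε * θ - ε * φ) := by
    rw [← mul_sub, cos_sign_mul hε]
  rw [h1, ← Complex.normSq_eq_norm_sq, Complex.normSq_apply, h2, Real.cos_sub]
  simp only [Complex.sub_re, Complex.sub_im, Complex.re_ofReal_mul, Complex.im_ofReal_mul,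
    Complex.exp_ofReal_mul_I_re, Complex.exp_ofReal_mul_I_im]
  linear_combination r ^ 2 * Real.sin_sq_add_cos_sq (ε * θ) + s ^ 2 * Real.sin_sq_add_cos_sq (ε * φ)

theorem polarPoint_eq_polarPoint_iff (hu : ‖u‖ = 1) (hε : ε = 1 ∨ ε = -1) {r : ℝ} (hr : 0 < r)
    (θ φ : ℝ) :
    polarPoint O u ε r θ = polarPoint O u ε r φ ↔ Real.cos (θ - φ) = 1 := by
  rw [← dist_eq_zero, ← sq_eq_zero_iff, dist_polarPoint_sq hu hε]
  have : r ^ 2 ≠ 0 := by positivity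
  constructor
  · intro h
    apply mul_left_cancel₀ this
    linarith
  · intro h
    rw [h]
    ring

theorem angle_polarPoint (hu : ‖u‖ = 1) (hε : ε = 1 ∨ ε = -1) {r : ℝ} (hr : 0 < r) (θ φ : ℝ) :
    EuclideanGeometry.angle (polarPoint O u ε r θ) O (polarPoint O u ε r φ) =
      Real.arccos (Real.cos (θ - φ)) := by
  have hn : ∀ θ, ‖polarPoint O u ε r θ - O‖ = r := fun θ => by
    rw [← dist_eq_norm]
    exact polarPoint_mem_sphere hu hr θ
  have h := norm_sub_sq_real (polarPoint O u ε r θ - O) (polarPoint O u ε r φ - O)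
  rw [sub_sub_sub_cancel_right, ← dist_eq_norm, dist_polarPoint_sq hu hε, hn, hn] at h
  rw [EuclideanGeometry.angle, vsub_eq_sub, vsub_eq_sub, InnerProductGeometry.angle, hn, hn]
  congr 1
  field_simp
  linarith

theorem exists_polarPoint_of_isRegularPolygon {n : ℕ} {P : Fin n → ℂ}
    (hP : IsRegularPolygonOnUnitCircle O P) :
    ∃ (u : ℂ) (ε : ℝ), ‖u‖ = 1 ∧ (ε = 1 ∨ ε = -1) ∧
      ∀ k : Fin n, P k = polarPoint O u ε 1 (2 * Real.pi * (k : ℕ) / n) := by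
  obtain ⟨u, ω, hu, hω, hPk⟩ := hP
  rcases hω with rfl | rfl
  · refine ⟨u, 1, hu, Or.inl rfl, fun k => ?_⟩
    rw [hPk, polarPoint, ← Complex.exp_nat_mul]
    push_cast
    rw [one_mul, one_mul]
    congr 3
    ring
  · refine ⟨u, -1, hu, Or.inr rfl, fun k => ?_⟩
    rw [hPk, polarPoint, ← Complex.exp_nat_mul]
    push_cast
    rw [one_mul]
    congr 3
    ring

theorem eq_polarPoint_of_isRayCirclePoint (hu : ‖u‖ = 1) {r θ : ℝ} {P B : ℂ}
    (hP : P = polarPoint O u ε 1 θ) (hB : IsRayCirclePoint O r P B) :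
    B = polarPoint O u ε r θ := by
  obtain ⟨hBr, hray⟩ := hB
  have h := hray.norm_smul_eq
  have h1 : ‖P - O‖ = 1 := by
    rw [hP, ← dist_eq_norm]
    exact polarPoint_mem_sphere hu one_pos θ
  have h2 : ‖B - O‖ = r := by
    rw [← dist_eq_norm]
    exact hBr
  rw [h1, h2, one_smul, hP] at h
  rw [sub_eq_iff_eq_add.1 h]
  simp [polarPoint]
  ring

/-- Law of cosines: `distPowSum` is `sqDistPowSum` with half the exponent. -/
theorem distPowSum_polarPoint (hu : ‖u‖ = 1) (hε : ε = 1 ∨ ε = -1) {n : ℕ} {P : Fin n → ℂ}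
    (hP : ∀ k : Fin n, P k = polarPoint O u ε 1 (2 * Real.pi * (k : ℕ) / n)) (r lam θ : ℝ) :
    distPowSum P lam (polarPoint O u ε r θ) = sqDistPowSum n r (lam / 2) θ := by
  rw [distPowSum, sqDistPowSum, ← Fin.sum_univ_eq_sum_range
    (fun k => (1 + r ^ 2 - 2 * r * Real.cos (vertexAngle n θ k)) ^ (lam / 2))]
  refine Finset.sum_congr rfl fun k _ => ?_
  have h := dist_polarPoint_sq (O := O) hu hε r 1 θ (2 * Real.pi * (k : ℕ) / n)
  rw [← hP k] at h
  rw [vertexAngle, show 1 + r ^ 2 - 2 * r * Real.cos (θ - 2 * Real.pi * (k : ℕ) / n) =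
    dist (polarPoint O u ε r θ) (P k) ^ 2 by rw [h]; ring,
    ← Real.rpow_natCast, ← Real.rpow_mul dist_nonneg]
  congr 1
  push_cast
  ring

/-! ### Vertices and midpoints in terms of the polar angle -/

theorem exists_nat_lt_eq_add_int_mul {n : ℕ} (hn : n ≠ 0) (m : ℤ) :
    ∃ k < n, ∃ q : ℤ, m = k + n * q := by
  have hn' : (n : ℤ) ≠ 0 := by exact_mod_cast hn
  have h0 := Int.emod_nonneg m hn'
  have h1 := Int.emod_lt_of_pos m (by omega : (0 : ℤ) < n)
  exact ⟨(m % n).toNat, by omega, m / n, by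
    rw [Int.toNat_of_nonneg h0]; exact (Int.emod_add_mul_ediv m n).symm⟩

theorem exists_eq_vertex_iff (hu : ‖u‖ = 1) (hε : ε = 1 ∨ ε = -1) {n : ℕ} (hn : n ≠ 0) {r : ℝ}
    (hr : 0 < r) {B : Fin n → ℂ}
    (hB : ∀ k : Fin n, B k = polarPoint O u ε r (2 * Real.pi * (k : ℕ) / n)) (θ : ℝ) :
    (∃ k, polarPoint O u ε r θ = B k) ↔ Real.cos (n * θ) = 1 := by
  have hn' : (n : ℝ) ≠ 0 := Nat.cast_ne_zero.2 hn
  simp only [hB, polarPoint_eq_polarPoint_iff hu hε hr]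
  constructor
  · rintro ⟨k, hk⟩
    by_contra h
    exact (cos_vertexAngle_lt_one hn h k).ne hk
  · intro h
    obtain ⟨m, hm⟩ := (Real.cos_eq_one_iff _).1 h
    obtain ⟨k, hk, q, rfl⟩ := exists_nat_lt_eq_add_int_mul hn m
    refine ⟨⟨k, hk⟩, (Real.cos_eq_one_iff _).2 ⟨q, ?_⟩⟩
    push_cast at hm
    field_simp
    linarith

/-- The successor of the last vertex in `Fin n` is the vertex `0`, which is also the point at polar
angle `2π`. -/
theorem polarPoint_fin_add_one (hε : ε = 1 ∨ ε = -1) {n : ℕ} [NeZero n] (r : ℝ) (k : Fin n) :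
    polarPoint O u ε r (2 * Real.pi * ((k + 1 : Fin n) : ℕ) / n) =
      polarPoint O u ε r (2 * Real.pi * (k : ℕ) / n + 2 * Real.pi / n) := by
  have hn' : (n : ℝ) ≠ 0 := Nat.cast_ne_zero.2 (NeZero.ne n)
  have hval : ((k + 1 : Fin n) : ℕ) = ((k : ℕ) + 1) % n := by
    rw [Fin.val_add, Fin.val_one', Nat.add_mod_mod]
  rcases (Nat.succ_le_of_lt k.isLt).lt_or_eq with h | h
  · rw [hval, Nat.mod_eq_of_lt h]
    congr 1
    push_cast
    ring
  · have hk : ((k : ℕ) : ℝ) = n - 1 := by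
      rw [eq_sub_iff_add_eq]
      exact_mod_cast h
    rw [hval, show (k : ℕ) + 1 = n from h, Nat.mod_self, hk, ← polarPoint_add_two_pi hε]
    congr 1
    field_simp
    push_cast
    ring

/-- Since `2 * δ ≤ π`, the arc from `α` to `α + 2 * δ` has central angle exactly `2 * δ`. -/
theorem bisectsArc_polarPoint_iff (hu : ‖u‖ = 1) (hε : ε = 1 ∨ ε = -1) {r : ℝ} (hr : 0 < r)
    {δ : ℝ} (hδ0 : 0 ≤ δ) (hδ : δ ≤ Real.pi / 2) (α θ : ℝ) :
    BisectsArc O (polarPoint O u ε r α) (polarPoint O u ε r (α + 2 * δ)) (polarPoint O u ε r θ) ↔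
      Real.cos (θ - α) = Real.cos δ ∧ Real.cos (θ - (α + 2 * δ)) = Real.cos δ := by
  have key : ∀ x, Real.arccos (Real.cos x) = δ ↔ Real.cos x = Real.cos δ := by
    intro x
    constructor
    · intro h
      rw [← h, Real.cos_arccos (Real.neg_one_le_cos x) (Real.cos_le_one x)]
    · intro h
      rw [h, Real.arccos_cos hδ0 (by linarith [Real.pi_pos])]
  have h1 : Real.arccos (Real.cos (α - (α + 2 * δ))) / 2 = δ := by
    rw [show α - (α + 2 * δ) = -(2 * δ) by ring, Real.cos_neg,
      Real.arccos_cos (by linarith) (by linarith)]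
    ring
  rw [BisectsArc, angle_polarPoint hu hε hr, angle_polarPoint hu hε hr, angle_polarPoint hu hε hr,
    h1, key, key, ← neg_sub θ α, Real.cos_neg]

theorem bisectsConsecutiveArc_iff (hu : ‖u‖ = 1) (hε : ε = 1 ∨ ε = -1) {n : ℕ} [NeZero n]
    (hn : 2 ≤ n) {r : ℝ} (hr : 0 < r) {B : Fin n → ℂ}
    (hB : ∀ k : Fin n, B k = polarPoint O u ε r (2 * Real.pi * (k : ℕ) / n)) (θ : ℝ) :
    BisectsConsecutiveArc O B (polarPoint O u ε r θ) ↔ Real.cos (n * θ) = -1 := by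
  have hn0 : n ≠ 0 := NeZero.ne n
  have hn' : (n : ℝ) ≠ 0 := Nat.cast_ne_zero.2 hn0
  have hδ : Real.pi / n ≤ Real.pi / 2 := by
    have : (2 : ℝ) ≤ n := by exact_mod_cast hn
    have := Real.pi_pos
    gcongr
  have hiff : ∀ k : Fin n, BisectsArc O (B k) (B (k + 1)) (polarPoint O u ε r θ) ↔
      Real.cos (vertexAngle n θ k) = Real.cos (Real.pi / n) ∧
        Real.cos (vertexAngle n θ k - 2 * (Real.pi / n)) = Real.cos (Real.pi / n) := by
    intro k
    rw [hB, hB, polarPoint_fin_add_one hε, mul_div_assoc 2 Real.pi (n : ℝ),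
      bisectsArc_polarPoint_iff hu hε hr (by positivity) hδ, ← sub_sub]
    rfl
  simp only [BisectsConsecutiveArc, hiff]
  constructor
  -- `T_n` sends `cos (π/n)` to `-1` and `cos (θ - 2πk/n)` to `cos (nθ)`
  · rintro ⟨k, hk, -⟩
    have h1 := Polynomial.Chebyshev.T_real_cos (vertexAngle n θ k) n
    have h2 := Polynomial.Chebyshev.T_real_cos (Real.pi / n) n
    rw [hk, h2] at h1
    rw [← cos_nat_mul_vertexAngle hn0 θ k]
    have h3 : ((n : ℤ) : ℝ) * (Real.pi / n) = Real.pi := by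
      push_cast
      field_simp
    rw [h3, Real.cos_pi] at h1
    exact_mod_cast h1.symm
  · intro h
    obtain ⟨m, hm⟩ := Real.cos_eq_neg_one_iff.1 h
    obtain ⟨k, hk, q, rfl⟩ := exists_nat_lt_eq_add_int_mul hn0 m
    have hv : vertexAngle n θ k = Real.pi / n + q * (2 * Real.pi) := by
      unfold vertexAngle
      push_cast at hm
      field_simp
      linarith
    refine ⟨⟨k, hk⟩, ?_, ?_⟩
    · rw [hv, Real.cos_add_int_mul_two_pi]
    · rw [hv, show Real.pi / n + q * (2 * Real.pi) - 2 * (Real.pi / n) =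
        -(Real.pi / n) + q * (2 * Real.pi) by ring, Real.cos_add_int_mul_two_pi, Real.cos_neg]

end

/-! ### Extrema of monotone functions of a parameter -/

section

variable {α β γ : Type*} [LinearOrder β] [LinearOrder γ] {S : Set α} {T : Set β} {φ : α → β}
  {g : β → γ} {f : α → γ} {a : β} {X : α}

theorem isMinOn_iff_of_strictMonoOn (hf : ∀ Y ∈ S, f Y = g (φ Y)) (hφ : MapsTo φ S T)
    (hsurj : SurjOn φ S T) (hg : StrictMonoOn g T) (ha : IsLeast T a) (hX : X ∈ S) :
    IsMinOn f S X ↔ φ X = a := by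
  constructor
  · intro h
    obtain ⟨Y, hY, rfl⟩ := hsurj ha.1
    have h1 : f X ≤ f Y := h hY
    rw [hf X hX, hf Y hY, hg.le_iff_le (hφ hX) (hφ hY)] at h1
    exact h1.antisymm (ha.2 (hφ hX))
  · intro h Y hY
    change f X ≤ f Y
    rw [hf X hX, hf Y hY, hg.le_iff_le (hφ hX) (hφ hY), h]
    exact ha.2 (hφ hY)

theorem isMaxOn_iff_of_strictMonoOn (hf : ∀ Y ∈ S, f Y = g (φ Y)) (hφ : MapsTo φ S T)
    (hsurj : SurjOn φ S T) (hg : StrictMonoOn g T) (ha : IsGreatest T a) (hX : X ∈ S) :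
    IsMaxOn f S X ↔ φ X = a :=
  isMinOn_iff_of_strictMonoOn (β := βᵒᵈ) (γ := γᵒᵈ) hf hφ hsurj hg.dual ha hX

theorem isMaxOn_iff_of_strictAntiOn (hf : ∀ Y ∈ S, f Y = g (φ Y)) (hφ : MapsTo φ S T)
    (hsurj : SurjOn φ S T) (hg : StrictAntiOn g T) (ha : IsLeast T a) (hX : X ∈ S) :
    IsMaxOn f S X ↔ φ X = a :=
  isMinOn_iff_of_strictMonoOn (γ := γᵒᵈ) hf hφ hsurj hg.dual_right ha hX

theorem isMinOn_iff_of_strictAntiOn (hf : ∀ Y ∈ S, f Y = g (φ Y)) (hφ : MapsTo φ S T)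
    (hsurj : SurjOn φ S T) (hg : StrictAntiOn g T) (ha : IsGreatest T a) (hX : X ∈ S) :
    IsMinOn f S X ↔ φ X = a :=
  isMaxOn_iff_of_strictMonoOn (γ := γᵒᵈ) hf hφ hsurj hg.dual_right ha hX

end

/-! ### Sign of the `n`-th derivative -/

/-- If exactly the first `m` of the factors `j - a` are negative, their product has the sign of
`(-1) ^ m`. -/
theorem neg_one_pow_mul_prod_range_sub_pos {n m : ℕ} {a : ℝ} (hm : m ≤ n)
    (hlt : ∀ j < m, (j : ℝ) < a) (hgt : ∀ j, m ≤ j → j < n → a < j) :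
    0 < (-1) ^ m * ∏ j ∈ Finset.range n, ((j : ℝ) - a) := by
  have h1 : (-1) ^ m * ∏ j ∈ Finset.range m, ((j : ℝ) - a) = ∏ j ∈ Finset.range m, (a - j) := by
    rw [mul_comm]
    nth_rw 2 [← Finset.card_range m]
    rw [Finset.prod_mul_pow_card]
    exact Finset.prod_congr rfl fun j _ => by ring
  rw [← Finset.prod_range_mul_prod_Ico _ hm, ← mul_assoc, h1]
  refine mul_pos (Finset.prod_pos fun j hj => ?_) (Finset.prod_pos fun j hj => ?_)
  · exact sub_pos.2 (hlt j (Finset.mem_range.1 hj))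
  · exact sub_pos.2 (hgt j (Finset.mem_Ico.1 hj).1 (Finset.mem_Ico.1 hj).2)

/-! ### Position of the polygon relative to the circle -/

theorem mem_sphere_one_of_isRegularPolygon {O : ℂ} {n : ℕ} {P : Fin n → ℂ}
    (hP : IsRegularPolygonOnUnitCircle O P) (k : Fin n) : P k ∈ Metric.sphere O 1 := by
  obtain ⟨u, ε, hu, -, hP⟩ := exists_polarPoint_of_isRegularPolygon hP
  rw [hP]
  exact polarPoint_mem_sphere hu one_pos _

theorem eq_of_isRayCirclePoint_one {O : ℂ} {n : ℕ} {P B : Fin n → ℂ}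
    (hP : IsRegularPolygonOnUnitCircle O P) (hB : ∀ k, IsRayCirclePoint O 1 (P k) (B k)) :
    P = B := by
  obtain ⟨u, ε, hu, -, hP⟩ := exists_polarPoint_of_isRegularPolygon hP
  funext k
  rw [eq_polarPoint_of_isRayCirclePoint hu (hP k) (hB k), hP k]

/-! ### The angle to the nearest vertex -/

/-- Folding the polar angle by the symmetries of the polygon gives a coordinate `φ` on the circle,
with values in `[0, π/n]`, namely the angle to the nearest vertex; the power sum is a function of
`φ`, the vertices are the points with `φ = 0` and the midpoints those with `φ = π/n`. -/
theorem exists_foldedAngle {O : ℂ} {n : ℕ} [NeZero n] (hn : 2 ≤ n) {P B : Fin n → ℂ}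
    (hP : IsRegularPolygonOnUnitCircle O P) {r : ℝ} (hr : 0 < r)
    (hB : ∀ k, IsRayCirclePoint O r (P k) (B k)) (lam : ℝ) :
    ∃ φ : ℂ → ℝ,
      (∀ X ∈ Metric.sphere O r, distPowSum P lam X = sqDistPowSum n r (lam / 2) (φ X)) ∧
      MapsTo φ (Metric.sphere O r) (Icc 0 (Real.pi / n)) ∧
      SurjOn φ (Metric.sphere O r) (Icc 0 (Real.pi / n)) ∧
      (∀ X ∈ Metric.sphere O r, (∃ k, X = B k) ↔ φ X = 0) ∧
      (∀ X ∈ Metric.sphere O r, BisectsConsecutiveArc O B X ↔ φ X = Real.pi / n) := by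
  have hn0 : n ≠ 0 := NeZero.ne n
  have hn' : (n : ℝ) ≠ 0 := Nat.cast_ne_zero.2 hn0
  have hnpos : (0 : ℝ) < n := Nat.cast_pos.2 (Nat.pos_of_ne_zero hn0)
  obtain ⟨u, ε, hu, hε, hP⟩ := exists_polarPoint_of_isRegularPolygon hP
  have hB := fun k => eq_polarPoint_of_isRayCirclePoint hu (hP k) (hB k)
  have hpolar : ∀ X : ℂ, ∃ θ, X ∈ Metric.sphere O r → X = polarPoint O u ε r θ := by
    intro X
    by_cases hX : X ∈ Metric.sphere O r
    · obtain ⟨θ, hθ⟩ := exists_polarPoint_eq hu hε hr hX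
      exact ⟨θ, fun _ => hθ⟩
    · exact ⟨0, fun h => absurd h hX⟩
  choose θ hθ using hpolar
  have hcos : ∀ X, Real.cos (n * (Real.arccos (Real.cos (n * θ X)) / n)) = Real.cos (n * θ X) := by
    intro X
    rw [mul_div_cancel₀ _ hn', Real.cos_arccos (Real.neg_one_le_cos _) (Real.cos_le_one _)]
  refine ⟨fun X => Real.arccos (Real.cos (n * θ X)) / n, ?_, ?_, ?_, ?_, ?_⟩
  · intro X hX
    conv_lhs => rw [hθ X hX, distPowSum_polarPoint hu hε hP]
    exact sqDistPowSum_eq_of_cos_eq hn0 _ _ (hcos X).symm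
  · intro X _
    exact ⟨div_nonneg (Real.arccos_nonneg _) hnpos.le,
      div_le_div_of_nonneg_right (Real.arccos_le_pi _) hnpos.le⟩
  · intro t ht
    have ht' := nat_mul_mem_Icc hn0 ht
    have hmem := polarPoint_mem_sphere (O := O) (ε := ε) hu hr t
    refine ⟨polarPoint O u ε r t, hmem, ?_⟩
    have h1 := (polarPoint_eq_polarPoint_iff hu hε hr _ _).1 (hθ _ hmem)
    obtain ⟨m, hm⟩ := (Real.cos_eq_one_iff _).1 h1
    have h2 : n * θ (polarPoint O u ε r t) = n * t - (n * m : ℤ) * (2 * Real.pi) := by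
      push_cast
      linear_combination (n : ℝ) * hm
    change Real.arccos (Real.cos (n * θ (polarPoint O u ε r t))) / n = t
    rw [h2, Real.cos_sub_int_mul_two_pi, Real.arccos_cos ht'.1 ht'.2, mul_div_cancel_left₀ _ hn']
  · intro X hX
    conv_lhs => rw [hθ X hX, exists_eq_vertex_iff hu hε hn0 hr hB]
    rw [div_eq_zero_iff, or_iff_left hn', Real.arccos_eq_zero]
    exact ⟨fun h => h.ge, fun h => (Real.cos_le_one _).antisymm h⟩
  · intro X hX
    conv_lhs => rw [hθ X hX, bisectsConsecutiveArc_iff hu hε hn hr hB]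
    rw [div_left_inj' hn', Real.arccos_eq_pi]
    exact ⟨fun h => h.le, fun h => h.antisymm (Real.neg_one_le_cos _)⟩

/-! ### Unboundedness near the vertices for negative exponents -/

theorem tendsto_distPowSum_atTop {n : ℕ} (P : Fin n → ℂ) {lam : ℝ} (hlam : lam < 0) (S : Set ℂ)
    (k : Fin n) : Tendsto (distPowSum P lam) (𝓝[S \ range P] (P k)) atTop := by
  have h1 : Tendsto (fun X => dist X (P k)) (𝓝[S \ range P] (P k)) (𝓝[>] 0) := by
    refine tendsto_nhdsWithin_iff.2 ⟨?_, ?_⟩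
    · have : Tendsto (fun X => dist X (P k)) (𝓝 (P k)) (𝓝 (dist (P k) (P k))) :=
        (continuous_id.dist continuous_const).tendsto (P k)
      rw [dist_self] at this
      exact this.mono_left nhdsWithin_le_nhds
    · filter_upwards [self_mem_nhdsWithin] with X hX
      exact dist_pos.2 fun h => hX.2 ⟨k, h.symm⟩
  refine tendsto_atTop_mono (fun X => ?_) ((tendsto_rpow_neg_nhdsGT_zero hlam).comp h1)
  exact Finset.single_le_sum (f := fun k => dist X (P k) ^ lam)
    (fun i _ => Real.rpow_nonneg dist_nonneg _) (Finset.mem_univ k)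

/-- The circle is connected, so it has no isolated points, even after finitely many points are
removed. -/
theorem neBot_nhdsWithin_sphere_diff {O : ℂ} {r : ℝ} (hr : 0 < r) {A : Set ℂ} (hA : A.Finite)
    {p : ℂ} (hp : p ∈ Metric.sphere O r) : (𝓝[Metric.sphere O r \ A] p).NeBot := by
  have hrank : 1 < Module.rank ℝ ℂ := Complex.rank_real_complex ▸ Nat.one_lt_ofNat
  have hnontriv : (Metric.sphere O r).Nontrivial := by
    refine ⟨O + r, by simp [abs_of_pos hr], O - r, by simp [abs_of_pos hr], fun h => ?_⟩
    have := congrArg Complex.re h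
    simp at this
    linarith
  have hacc : AccPt p (𝓟 (Metric.sphere O r)) :=
    (isPreconnected_sphere hrank O r).preperfect_of_nontrivial hnontriv p hp
  refine NeBot.mono hacc (le_inf (inf_le_left.trans nhdsWithin_le_nhds) ?_)
  have h1 : (A \ {p})ᶜ ∈ 𝓝 p :=
    (hA.subset sdiff_subset).isClosed.isOpen_compl.mem_nhds (by simp)
  refine le_principal_iff.2 ?_
  filter_upwards [mem_inf_of_left (mem_nhdsWithin_of_mem_nhds h1),
    mem_inf_of_left self_mem_nhdsWithin, mem_inf_of_right (mem_principal_self _)] with x h h' h''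
  exact ⟨h'', fun hx => h ⟨hx, h'⟩⟩

/-! ### Location of the extrema -/

theorem theorem2 (n : ℕ) [NeZero n] (hn : 3 ≤ n) (O : ℂ) (P : Fin n → ℂ)
    (hP : IsRegularPolygonOnUnitCircle O P) (r : ℝ) (hr : 0 < r) (B : Fin n → ℂ)
    (hB : ∀ k, IsRayCirclePoint O r (P k) (B k)) (lam : ℝ) :
    -- negative exponents
    (lam < 0 →
      (∀ X ∈ Metric.sphere O r \ range P,
        (IsMinOn (distPowSum P lam) (Metric.sphere O r \ range P) X ↔
          BisectsConsecutiveArc O B X)) ∧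
      (r ≠ 1 → ∀ X ∈ Metric.sphere O r,
        (IsMinOn (distPowSum P lam) (Metric.sphere O r) X ↔ BisectsConsecutiveArc O B X) ∧
        (IsMaxOn (distPowSum P lam) (Metric.sphere O r) X ↔ ∃ k, X = B k)) ∧
      (r = 1 →
        ¬ BddAbove (distPowSum P lam '' (Metric.sphere O r \ range P)) ∧
        ∀ k, Tendsto (distPowSum P lam) (𝓝[Metric.sphere O r \ range P] (B k)) atTop)) ∧
    -- exponents in `[0, 2n)`
    (0 ≤ lam → lam < 2 * n →
      ((∃ j : ℤ, lam = 2 * j) →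
        ∀ X ∈ Metric.sphere O r, ∀ Y ∈ Metric.sphere O r,
          distPowSum P lam X = distPowSum P lam Y) ∧
      ((¬ ∃ j : ℤ, lam = 2 * j) → ∀ m : ℤ, 2 * m ≤ lam → lam ≤ 2 * m + 2 →
        (Even m → ∀ X ∈ Metric.sphere O r,
          (IsMaxOn (distPowSum P lam) (Metric.sphere O r) X ↔ BisectsConsecutiveArc O B X) ∧
          (IsMinOn (distPowSum P lam) (Metric.sphere O r) X ↔ ∃ k, X = B k)) ∧
        (Odd m → ∀ X ∈ Metric.sphere O r,
          (IsMinOn (distPowSum P lam) (Metric.sphere O r) X ↔ BisectsConsecutiveArc O B X) ∧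
          (IsMaxOn (distPowSum P lam) (Metric.sphere O r) X ↔ ∃ k, X = B k)))) ∧
    -- exponents `≥ 2n`
    (2 * n ≤ lam →
      (Even n → ∀ X ∈ Metric.sphere O r,
        (IsMaxOn (distPowSum P lam) (Metric.sphere O r) X ↔ ∃ k, X = B k) ∧
        (IsMinOn (distPowSum P lam) (Metric.sphere O r) X ↔ BisectsConsecutiveArc O B X)) ∧
      (Odd n → ∀ X ∈ Metric.sphere O r,
        (IsMinOn (distPowSum P lam) (Metric.sphere O r) X ↔ ∃ k, X = B k) ∧
        (IsMaxOn (distPowSum P lam) (Metric.sphere O r) X ↔ BisectsConsecutiveArc O B X))) := by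
  have hn0 : n ≠ 0 := NeZero.ne n
  have hpi : 0 < Real.pi / n := div_pos Real.pi_pos (Nat.cast_pos.2 (Nat.pos_of_ne_zero hn0))
  obtain ⟨φ, hf, hmaps, hsurj, hvert, hmid⟩ := exists_foldedAngle (by omega) hP hr hB lam
  have hleast : IsLeast (Icc 0 (Real.pi / n)) 0 := isLeast_Icc hpi.le
  have hgreatest : IsGreatest (Icc 0 (Real.pi / n)) (Real.pi / n) := isGreatest_Icc hpi.le
  -- a negative sign of the derivative puts the maximum at the vertices
  have hanti : 0 < ∏ j ∈ Finset.range n, ((j : ℝ) - lam / 2) →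
      ContinuousOn (sqDistPowSum n r (lam / 2)) (Icc 0 (Real.pi / n)) →
      ∀ X ∈ Metric.sphere O r,
        (IsMinOn (distPowSum P lam) (Metric.sphere O r) X ↔ BisectsConsecutiveArc O B X) ∧
        (IsMaxOn (distPowSum P lam) (Metric.sphere O r) X ↔ ∃ k, X = B k) := by
    intro hD hcont X hX
    have hg := strictAntiOn_sqDistPowSum hn0 hr hD (convex_Icc _ _) Subset.rfl hcont
    rw [hmid X hX, hvert X hX]
    exact ⟨isMinOn_iff_of_strictAntiOn hf hmaps hsurj hg hgreatest hX,
      isMaxOn_iff_of_strictAntiOn hf hmaps hsurj hg hleast hX⟩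
  have hmono : ∏ j ∈ Finset.range n, ((j : ℝ) - lam / 2) < 0 → 0 ≤ lam →
      ∀ X ∈ Metric.sphere O r,
        (IsMaxOn (distPowSum P lam) (Metric.sphere O r) X ↔ BisectsConsecutiveArc O B X) ∧
        (IsMinOn (distPowSum P lam) (Metric.sphere O r) X ↔ ∃ k, X = B k) := by
    intro hD hlam X hX
    have hg := strictMonoOn_sqDistPowSum hn0 hr hD (convex_Icc _ _) Subset.rfl
      (continuous_sqDistPowSum n r (by linarith)).continuousOn
    rw [hmid X hX, hvert X hX]
    exact ⟨isMaxOn_iff_of_strictMonoOn hf hmaps hsurj hg hgreatest hX,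
      isMinOn_iff_of_strictMonoOn hf hmaps hsurj hg hleast hX⟩
  have hcont : 0 ≤ lam → ContinuousOn (sqDistPowSum n r (lam / 2)) (Icc 0 (Real.pi / n)) :=
    fun h => (continuous_sqDistPowSum n r (by linarith)).continuousOn
  refine ⟨fun hlam => ?_, fun hlam0 hlam2 => ⟨?_, ?_⟩, fun hlam => ?_⟩
  · have hD : 0 < ∏ j ∈ Finset.range n, ((j : ℝ) - lam / 2) :=
      Finset.prod_pos fun j _ => by
        have : (0 : ℝ) ≤ j := j.cast_nonneg
        linarith
    have hne : r ≠ 1 → ∀ X ∈ Metric.sphere O r,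
        (IsMinOn (distPowSum P lam) (Metric.sphere O r) X ↔ BisectsConsecutiveArc O B X) ∧
        (IsMaxOn (distPowSum P lam) (Metric.sphere O r) X ↔ ∃ k, X = B k) := by
      intro hr1
      refine hanti hD (continuousOn_sqDistPowSum _ fun θ _ k => ?_)
      have h1 : 0 < (1 - r) ^ 2 := by
        have : 1 - r ≠ 0 := sub_ne_zero.2 hr1.symm
        positivity
      nlinarith [mul_nonneg hr.le (sub_nonneg.2 (Real.cos_le_one (vertexAngle n θ k)))]
    refine ⟨?_, hne, ?_⟩
    · by_cases hr1 : r = 1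
      · subst hr1
        have hPB : ∀ X ∈ Metric.sphere O 1, X ∈ range P ↔ φ X = 0 := by
          intro X hX
          rw [← hvert X hX, eq_of_isRayCirclePoint_one hP hB]
          exact exists_congr fun k => eq_comm
        -- the vertices, at `φ = 0`, are the poles of the power sum and are left out
        have hg := strictAntiOn_sqDistPowSum hn0 hr hD (convex_Ioc 0 (Real.pi / n))
          Ioc_subset_Icc_self (continuousOn_sqDistPowSum _ fun θ hθ k =>
            one_add_sq_sub_pos hr (cos_vertexAngle_lt_one hn0 (fun h => by
              have h1 := nat_mul_mem_Icc hn0 (Ioc_subset_Icc_self hθ)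
              have h2 := Real.injOn_cos h1 (left_mem_Icc.2 Real.pi_pos.le)
                (h.trans Real.cos_zero.symm)
              exact (mul_pos (Nat.cast_pos.2 (Nat.pos_of_ne_zero hn0)) hθ.1).ne' h2) k))
        intro X hX
        rw [hmid X hX.1]
        refine isMinOn_iff_of_strictAntiOn (fun Y hY => hf Y hY.1) ?_ ?_ hg
          (isGreatest_Ioc hpi) hX
        · intro Y hY
          have h1 := hmaps hY.1
          exact ⟨h1.1.lt_of_ne' fun h => hY.2 ((hPB Y hY.1).2 h), h1.2⟩
        · intro t ht
          obtain ⟨Y, hY, rfl⟩ := hsurj (Ioc_subset_Icc_self ht)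
          exact ⟨Y, ⟨hY, fun h => ht.1.ne' ((hPB Y hY).1 h)⟩, rfl⟩
      · have hdiff : Metric.sphere O r \ range P = Metric.sphere O r := by
          refine sdiff_eq_left.2 (disjoint_right.2 ?_)
          rintro _ ⟨k, rfl⟩ hk
          exact hr1 ((Metric.mem_sphere.1 hk).symm.trans
            (mem_sphere_one_of_isRegularPolygon hP k))
        rw [hdiff]
        exact fun X hX => (hne hr1 X hX).1
    · rintro rfl
      obtain rfl := eq_of_isRayCirclePoint_one hP hB
      have htend := tendsto_distPowSum_atTop P hlam (Metric.sphere O 1)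
      refine ⟨?_, htend⟩
      rintro ⟨C, hC⟩
      have := neBot_nhdsWithin_sphere_diff hr (finite_range P) (hB 0).1
      obtain ⟨X, hX, hCX⟩ := (eventually_mem_nhdsWithin.and
        ((htend 0).eventually (eventually_gt_atTop C))).exists
      exact hCX.not_ge (hC (mem_image_of_mem _ hX))
  · rintro ⟨j, rfl⟩ X hX Y hY
    rw [hf X hX, hf Y hY]
    have hj0 : 0 ≤ j := by
      have : (0 : ℝ) ≤ j := by linarith
      exact_mod_cast this
    lift j to ℕ using hj0
    refine sqDistPowSum_eq_of_prod_eq_zero hn0 hr (by linarith) ?_ (hmaps hX) (hmaps hY)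
    refine Finset.prod_eq_zero (i := j) (Finset.mem_range.2 ?_) ?_
    · push_cast at hlam2
      have : (j : ℝ) < n := by linarith
      exact_mod_cast this
    · push_cast
      ring
  · intro hne m hm1 hm2
    have hlt : (m : ℝ) < lam / 2 :=
      lt_of_le_of_ne (by linarith) fun h => hne ⟨m, by linarith⟩
    have hgt : lam / 2 < m + 1 :=
      lt_of_le_of_ne (by linarith) fun h => hne ⟨m + 1, by push_cast; linarith⟩
    have hm0 : 0 ≤ m := by
      have : (-1 : ℝ) < m := by linarith
      have : -1 < m := by exact_mod_cast this
      omega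
    lift m to ℕ using hm0
    push_cast at hlt hgt
    have hmn : m + 1 ≤ n := by
      have : (m : ℝ) < n := by linarith
      have : m < n := by exact_mod_cast this
      omega
    have hsign := neg_one_pow_mul_prod_range_sub_pos (a := lam / 2) hmn
      (fun j hj => lt_of_le_of_lt (by exact_mod_cast Nat.lt_succ_iff.1 hj) hlt)
      (fun j hj _ => hgt.trans_le (by exact_mod_cast hj))
    refine ⟨fun heven => hmono ?_ hlam0, fun hodd => hanti ?_ (hcont hlam0)⟩
    · rw [((Int.even_coe_nat m).1 heven).add_one.neg_one_pow] at hsign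
      linarith
    · rwa [((Int.odd_coe_nat m).1 hodd).add_one.neg_one_pow, one_mul] at hsign
  · have hlam0 : 0 ≤ lam := le_trans (by positivity) hlam
    have hsign := neg_one_pow_mul_prod_range_sub_pos (a := lam / 2) le_rfl
      (fun j (hj : j < n) => by
        have : (j : ℝ) < n := Nat.cast_lt.2 hj
        linarith)
      (fun j hj hj' => absurd hj' hj.not_gt)
    refine ⟨fun heven X hX => ?_, fun hodd X hX => ?_⟩
    · rw [heven.neg_one_pow, one_mul] at hsign
      exact (hanti hsign (hcont hlam0) X hX).symm
    · rw [hodd.neg_one_pow] at hsign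
      exact (hmono (by linarith) hlam0 X hX).symm
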